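/- A locally compact, $\sigma$-compact topological group $\Gamma$ has property (T) if every continuous action of $\Gamma$ by isometries on a Hilbert space has a fixed point. For $\varepsilon\ge 0$, a map $h:Z\to Y$ of metric spaces is an $\varepsilon$-almost isometry if $$(1-\varepsilon)\,d_Z(x,y)\le d_Y(h(x),h(y))\le (1+\varepsilon)\,d_Z(x,y)\qquad\text{for all }x,y\in Z.$$ If $\Gamma$ acts on a metric space $X$ and $K\subset\Gamma$ is compact, the $K$-displacement of $x\in X$ is $\operatorname{disp}_K(x)=\sup_{k\in K}d(x,k\cdot x)$ (with $\operatorname{disp}_K(x)=0$ if $K=\emptyset$). **Theorem.** Let $\Gamma$ be a locally compact, $\sigma$-compact group with property (T), and let $K\subset\Gamma$ be a compact set generating $\Gamma$ as a group. There exist constants $\varepsilon>0$ and $D>0$, depending only on $\Gamma$ and $K$, such that for every Hilbert space $\mathcal H$ and every continuous action $\Gamma\times\mathcal H\to\mathcal H$ (not assumed to be linear or affine) in which each $k\in K$ acts by an $\varepsilon$-almost isometry, the set $\mathcal H^\Gamma$ of points of $\mathcal H$ fixed by $\Gamma$ is non-empty, and for every $y\in\mathcal H$ $$d(y,\mathcal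 H^\Gamma)\le D\,\operatorname{disp}_K(y).$$ -/

import Mathlib

universe u v

/-- A topological group `Γ` has property (T), in the fixed-point form: every (jointly) continuous
action of `Γ` by isometries on a Hilbert space has a fixed point. Isometries are those of the
underlying metric space, so actions on complex Hilbert spaces are covered by restriction of scalars
to `ℝ`. For a σ-compact group the closed affine span of an orbit is separable, so the property does
not depend on the universe `v` in which the Hilbert spaces live. -/
def PropertyT (Γ : Type u) [Group Γ] [TopologicalSpace Γ] : Prop :=
  ∀ (H : Type v) [NormedAddCommGroup H] [InnerProductSpace ℝ H] [CompleteSpace H]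
    [MulAction Γ H] [ContinuousSMul Γ H],
    (∀ g : Γ, Isometry (fun x : H => g • x)) → ∃ x : H, ∀ g : Γ, g • x = x

/-- `h : Z → Y` is an `ε`-almost isometry:
`(1 - ε) d(x, y) ≤ d(h x, h y) ≤ (1 + ε) d(x, y)` for all `x`, `y`. -/
def IsAlmostIsometry {Z Y : Type*} [MetricSpace Z] [MetricSpace Y] (ε : ℝ) (h : Z → Y) : Prop :=
  ∀ x y : Z, (1 - ε) * dist x y ≤ dist (h x) (h y) ∧ dist (h x) (h y) ≤ (1 + ε) * dist x y

/-- The `K`-displacement `sup_{k ∈ K} d(x, k • x)` of a point `x`. The supremum is that of a bounded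
set when `K` is compact and the action is continuous; it is `0` when `K` is empty. -/
noncomputable def displacement {Γ X : Type*} [Group Γ] [MetricSpace X] [MulAction Γ X]
    (K : Set Γ) (x : X) : ℝ :=
  sSup ((fun k : Γ => dist x (k • x)) '' K)

open Filter Topology Set MeasureTheory
open scoped Pointwise

/-! It is enough to halve displacements: if every point `y` with displacement at most `D` has a
point within `C * D` with displacement at most `D / 2`, iteration gives a geometric Cauchy sequence
whose limit is fixed and within `2 * C * D` of `y` (`exists_mem_fixedPoints_dist_le`). A homothety
reduces halving to `y = 0`, `D = 1`.

If halving fails for every `ε` and `C`, there are actions with constants `ε n → 0` that move the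
origin by at most `1` but have no point of displacement at most `1 / 2` in the ball of radius `n`.
Their limit along an ultrafilter is an action by isometries, and property (T) should give it a fixed
point, hence almost fixed points at bounded distance in the original spaces: a contradiction.

The difficulty is that the limit action on all bounded sequences need not be continuous. It is
restricted to tame sequences. Averaging the orbit of the origin against a continuous density on `Γ`
produces one (`AsymptoticallyIsometric.exists_isTame`). Since distances determine barycenters in a
Hilbert space, almost isometries almost preserve them; hence tame sequences are closed under affine
combinations and form a linear space around a tame origin. Tameness also makes almost fixedness
uniform over the compact set `K`. -/

/-- `h` and its inverse relation are both Lipschitz with constant `c`. -/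
def IsBilipschitz {Z Y : Type*} [MetricSpace Z] [MetricSpace Y] (c : ℝ) (h : Z → Y) : Prop :=
  ∀ x y : Z, dist (h x) (h y) ≤ c * dist x y ∧ dist x y ≤ c * dist (h x) (h y)

/-- The symmetrization of `K` together with the identity. -/
def symmHull {Γ : Type*} [Group Γ] (K : Set Γ) : Set Γ := insert 1 (K ∪ K⁻¹)

/-! ### Words in the generators and compact subsets of the group -/

section Words

variable {Γ : Type*} [Group Γ] {K : Set Γ}

theorem one_mem_symmHull : (1 : Γ) ∈ symmHull K := mem_insert _ _

theorem symmHull_pow_mono : Monotone fun m : ℕ => symmHull K ^ m :=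
  fun _ _ h => Set.pow_right_monotone one_mem_symmHull h

theorem iUnion_symmHull_pow (hgen : Subgroup.closure K = ⊤) :
    ⋃ m : ℕ, symmHull K ^ m = univ := by
  refine eq_univ_of_forall fun g => ?_
  have hg : g ∈ Subgroup.closure K := hgen ▸ Subgroup.mem_top g
  rw [mem_iUnion]
  induction hg using Subgroup.closure_induction'' with
  | one => exact ⟨0, by simp⟩
  | mem x hx => exact ⟨1, by simp [symmHull, hx]⟩
  | inv_mem x hx => exact ⟨1, by simp [symmHull, hx]⟩
  | mul x y _ _ hx hy =>
    obtain ⟨m, hm⟩ := hx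
    obtain ⟨j, hj⟩ := hy
    exact ⟨m + j, by rw [pow_add]; exact mul_mem_mul hm hj⟩

variable {H : Type*} [MetricSpace H] [MulAction Γ H] {ε : ℝ}

theorem isBilipschitz_of_mem_symmHull (h0 : 0 ≤ ε) (h1 : ε ≤ 1 / 2)
    (hK : ∀ k ∈ K, IsAlmostIsometry ε (fun x : H => k • x)) {s : Γ} (hs : s ∈ symmHull K) :
    IsBilipschitz (1 - ε)⁻¹ (fun x : H => s • x) := by
  have hpos : 0 < 1 - ε := by linarith
  have hle : 1 ≤ (1 - ε)⁻¹ := (one_le_inv₀ hpos).2 (by linarith)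
  have key : ∀ k ∈ K, IsBilipschitz (1 - ε)⁻¹ (fun x : H => k • x) := fun k hk x y => by
    obtain ⟨h2, h3⟩ := hK k hk x y
    refine ⟨h3.trans (mul_le_mul_of_nonneg_right ?_ dist_nonneg), (le_inv_mul_iff₀ hpos).2 h2⟩
    rw [← one_div, le_div_iff₀ hpos]
    nlinarith
  rcases hs with rfl | hs | hs
  · intro x y
    simpa using le_mul_of_one_le_left dist_nonneg hle
  · exact key s hs
  · intro x y
    have := key _ hs (s • x) (s • y)
    simp only [inv_smul_smul] at this
    exact ⟨this.2, this.1⟩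

variable [TopologicalSpace Γ]

theorem isBilipschitz_of_mem_closure [ContinuousSMul Γ H] (h0 : 0 ≤ ε) (h1 : ε ≤ 1 / 2)
    (hK : ∀ k ∈ K, IsAlmostIsometry ε (fun x : H => k • x)) {m : ℕ} {g : Γ}
    (hg : g ∈ closure (symmHull K ^ m)) :
    IsBilipschitz ((1 - ε)⁻¹ ^ m) (fun x : H => g • x) := by
  have hpos : 0 ≤ (1 - ε)⁻¹ := inv_nonneg.2 (by linarith)
  have key : ∀ m : ℕ, ∀ g ∈ symmHull K ^ m,
      IsBilipschitz ((1 - ε)⁻¹ ^ m) (fun x : H => g • x) := by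
    intro m
    induction m with
    | zero =>
      intro g hg x y
      obtain rfl : g = 1 := by simpa using hg
      simp
    | succ m ih =>
      intro g hg x y
      rw [pow_succ'] at hg ⊢
      obtain ⟨s, hs, g, hg, rfl⟩ := hg
      have hA := isBilipschitz_of_mem_symmHull h0 h1 hK hs (g • x) (g • y)
      have hB := ih g hg x y
      simp only [mul_smul] at *
      refine ⟨hA.1.trans ?_, hB.2.trans ?_⟩
      · rw [mul_assoc]
        exact mul_le_mul_of_nonneg_left hB.1 hpos
      · rw [mul_comm (1 - ε)⁻¹, mul_assoc]
        exact mul_le_mul_of_nonneg_left hA.2 (pow_nonneg hpos m)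
  -- For fixed `x` and `y` both bounds are closed conditions on `g`, so they pass to the closure.
  intro x y
  refine closure_minimal (t := {g : Γ | dist (g • x) (g • y) ≤ (1 - ε)⁻¹ ^ m * dist x y ∧
    dist x y ≤ (1 - ε)⁻¹ ^ m * dist (g • x) (g • y)}) (fun g hg => key m g hg x y) ?_ hg
  rw [ofPred_and]
  exact (isClosed_le (by fun_prop) (by fun_prop)).inter (isClosed_le (by fun_prop) (by fun_prop))

theorem dist_smul_le_of_mem_closure [ContinuousSMul Γ H] (h0 : 0 ≤ ε) (h1 : ε ≤ 1 / 2)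
    (hK : ∀ k ∈ K, IsAlmostIsometry ε (fun x : H => k • x)) {m : ℕ} {g : Γ}
    (hg : g ∈ closure (symmHull K ^ m)) {x : H} {D : ℝ} (hD : ∀ k ∈ K, dist x (k • x) ≤ D)
    (hD0 : 0 ≤ D) : dist x (g • x) ≤ 4 ^ m * D := by
  have h2 : (1 - ε)⁻¹ ≤ 2 := by
    rw [inv_le_comm₀ (by linarith) two_pos]
    linarith
  have hS : ∀ s ∈ symmHull K, dist x (s • x) ≤ 2 * D := by
    rintro s (rfl | hs | hs)
    · simpa using hD0
    · linarith [hD s hs]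
    · have hb := (isBilipschitz_of_mem_symmHull h0 h1 hK (mem_insert_of_mem _ (Or.inr hs))
        x (s⁻¹ • x)).1
      simp only [smul_inv_smul] at hb
      rw [dist_comm]
      exact hb.trans (mul_le_mul h2 (hD _ hs) dist_nonneg two_pos.le)
  have key : ∀ m : ℕ, ∀ g ∈ symmHull K ^ m, dist x (g • x) ≤ 4 ^ m * D := by
    intro m
    induction m with
    | zero =>
      intro g hg
      obtain rfl : g = 1 := by simpa using hg
      simpa using hD0
    | succ m ih =>
      intro g hg
      rw [pow_succ'] at hg ⊢
      obtain ⟨s, hs, g, hg, rfl⟩ := hg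
      have hA := (isBilipschitz_of_mem_symmHull h0 h1 hK hs x (g • x)).1
      have hB := hA.trans (mul_le_mul h2 (ih g hg) dist_nonneg two_pos.le)
      have hT := dist_triangle x (s • x) (s • g • x)
      have h4 : D ≤ 4 ^ m * D := le_mul_of_one_le_left hD0 (one_le_pow₀ (by norm_num))
      simp only [mul_smul] at *
      -- The recursion is `2 * D + 2 * (4 ^ m * D) ≤ 4 * (4 ^ m * D)`.
      linarith [hS s hs]
  refine closure_minimal (t := {g : Γ | dist x (g • x) ≤ 4 ^ m * D}) (key m) ?_ hg
  exact isClosed_le (by fun_prop) (by fun_prop)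

variable [IsTopologicalGroup Γ]

theorem mul_mem_closure_symmHull_pow {m j : ℕ} {g h : Γ} (hg : g ∈ closure (symmHull K ^ m))
    (hh : h ∈ closure (symmHull K ^ j)) : g * h ∈ closure (symmHull K ^ (m + j)) :=
  map_mem_closure₂ (f := fun a b : Γ => a * b) (by fun_prop) hg hh
    fun a ha b hb => by rw [pow_add]; exact mul_mem_mul ha hb

/-- Baire category: countably many closed sets `closure (symmHull K ^ m)` cover `Γ`, so one has
interior. Translates of that interior lie in later members, so the interiors form an increasing open
cover. -/
theorem IsCompact.subset_closure_symmHull_pow [LocallyCompactSpace Γ]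
    (hgen : Subgroup.closure K = ⊤) {T : Set Γ} (hT : IsCompact T) :
    ∃ m : ℕ, T ⊆ closure (symmHull K ^ m) := by
  have hcov : ⋃ m : ℕ, closure (symmHull K ^ m) = univ :=
    univ_subset_iff.1 ((iUnion_symmHull_pow hgen).ge.trans
      (iUnion_mono fun _ => subset_closure))
  obtain ⟨m, x, hx⟩ := nonempty_interior_of_iUnion_of_closed (fun _ => isClosed_closure) hcov
  obtain ⟨j, hj⟩ := hT.elim_directed_cover (fun m : ℕ => interior (closure (symmHull K ^ m)))
    (fun _ => isOpen_interior) (fun g _ => by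
      obtain ⟨i, hi⟩ := mem_iUnion.1 (hcov.ge (mem_univ (g * x⁻¹)))
      refine mem_iUnion.2 ⟨i + m, mem_interior.2
        ⟨(g * x⁻¹) • interior (closure (symmHull K ^ m)), ?_, isOpen_interior.smul _, ?_⟩⟩
      · rintro _ ⟨y, hy, rfl⟩
        exact mul_mem_closure_symmHull_pow hi (interior_subset hy)
      · exact ⟨x, hx, by simp⟩)
    (Monotone.directed_le fun _ _ h => interior_mono (closure_mono (symmHull_pow_mono h)))
  exact ⟨j, hj.trans interior_subset⟩

end Words

/-! ### Barycenters and variance in Hilbert space -/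

section Barycenter

variable {Γ : Type*} [TopologicalSpace Γ] [MeasurableSpace Γ] [BorelSpace Γ] {μ : Measure Γ}
  [IsFiniteMeasureOnCompacts μ] {H : Type*} [NormedAddCommGroup H] [InnerProductSpace ℝ H]
  {f : Γ → ℝ}

theorem integrable_smul_of_hasCompactSupport (hf : Continuous f) (hfs : HasCompactSupport f)
    {F : Γ → H} (hF : Continuous F) : Integrable (fun g => f g • F g) μ :=
  (hf.smul hF).integrable_of_hasCompactSupport hfs.smul_right

theorem integrable_mul_of_hasCompactSupport (hf : Continuous f) (hfs : HasCompactSupport f)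
    {F : Γ → ℝ} (hF : Continuous F) : Integrable (fun g => f g * F g) μ :=
  (hf.mul hF).integrable_of_hasCompactSupport hfs.mul_right

variable [CompleteSpace H]

/-- Bias-variance decomposition for the barycenter of `F` with respect to the density `f`. -/
theorem integral_mul_norm_sub_sq (hf : Continuous f) (hfs : HasCompactSupport f)
    (hf1 : ∫ g, f g ∂μ = 1) {F : Γ → H} (hF : Continuous F) (c : H) :
    ∫ g, f g * ‖c - F g‖ ^ 2 ∂μ = ‖c - ∫ g, f g • F g ∂μ‖ ^ 2 +
      ∫ g, f g * ‖(∫ g, f g • F g ∂μ) - F g‖ ^ 2 ∂μ := by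
  set b := ∫ g, f g • F g ∂μ with hb
  have hfi : Integrable f μ := hf.integrable_of_hasCompactSupport hfs
  have h0 : ∫ g, f g • (b - F g) ∂μ = 0 := by
    simp_rw [smul_sub]
    rw [integral_sub (hfi.smul_const b) (integrable_smul_of_hasCompactSupport hf hfs hF),
      integral_smul_const, hf1, one_smul, ← hb, sub_self]
  have h1 : ∫ g, f g * inner ℝ (c - b) (b - F g) ∂μ = 0 := by
    have : ∀ g, f g * inner ℝ (c - b) (b - F g) = inner ℝ (c - b) (f g • (b - F g)) := fun g => by
      rw [inner_smul_right]
    simp_rw [this]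
    rw [integral_inner (integrable_smul_of_hasCompactSupport hf hfs (by fun_prop)), h0,
      inner_zero_right]
  have h2 : ∀ g, f g * ‖c - F g‖ ^ 2 = f g * ‖c - b‖ ^ 2 +
      2 * (f g * inner ℝ (c - b) (b - F g)) + f g * ‖b - F g‖ ^ 2 := fun g => by
    rw [show c - F g = (c - b) + (b - F g) by abel, norm_add_sq_real]
    ring
  have i1 : Integrable (fun g => f g * ‖c - b‖ ^ 2) μ := hfi.mul_const _
  have i2 : Integrable (fun g => 2 * (f g * inner ℝ (c - b) (b - F g))) μ :=
    (integrable_mul_of_hasCompactSupport hf hfs (by fun_prop)).const_mul 2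
  have i3 : Integrable (fun g => f g * ‖b - F g‖ ^ 2) μ :=
    integrable_mul_of_hasCompactSupport hf hfs (by fun_prop)
  simp_rw [h2]
  rw [integral_add (by exact i1.add i2) i3, integral_add i1 i2, integral_mul_const, hf1,
    integral_const_mul, h1]
  ring

/-- Averaging the bias-variance identity over `c = F t` expresses the variance through pairwise
distances alone, which almost isometries control. -/
theorem integral_mul_integral_mul_norm_sub_sq (hf : Continuous f) (hfs : HasCompactSupport f)
    (hf1 : ∫ g, f g ∂μ = 1) {F : Γ → H} (hF : Continuous F) :
    ∫ t, f t * ∫ g, f g * ‖F t - F g‖ ^ 2 ∂μ ∂μ =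
      2 * ∫ g, f g * ‖(∫ g, f g • F g ∂μ) - F g‖ ^ 2 ∂μ := by
  simp_rw [fun t => integral_mul_norm_sub_sq hf hfs hf1 hF (F t), mul_add]
  rw [integral_add (integrable_mul_of_hasCompactSupport hf hfs (by fun_prop))
    ((hf.integrable_of_hasCompactSupport hfs).mul_const _), integral_mul_const, hf1, one_mul,
    two_mul]
  simp_rw [norm_sub_rev]

/-- A point whose distances to the values of `G` are almost those of the barycenter of `F` to the
values of `F` is close to the barycenter of `G`. -/
theorem norm_sub_barycenter_sq_le (hf : Continuous f) (hfs : HasCompactSupport f)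
    (hf0 : ∀ g, 0 ≤ f g) (hf1 : ∫ g, f g ∂μ = 1) {F G : Γ → H} (hF : Continuous F)
    (hG : Continuous G) {c l : ℝ} {b : H} (hl : 0 < l)
    (hFG : ∀ s t, ‖F t - F s‖ ≤ l * ‖G t - G s‖)
    (hb : ∀ s, ‖b - G s‖ ≤ l * ‖(∫ g, f g • F g ∂μ) - F s‖)
    (hc : ∫ g, f g * ‖(∫ g, f g • F g ∂μ) - F g‖ ^ 2 ∂μ ≤ c) (hl1 : 1 ≤ l) :
    ‖b - ∫ g, f g • G g ∂μ‖ ^ 2 ≤ (l ^ 2 - (l ^ 2)⁻¹) * c := by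
  set vF := ∫ g, f g * ‖(∫ g, f g • F g ∂μ) - F g‖ ^ 2 ∂μ with hvF
  set vG := ∫ g, f g * ‖(∫ g, f g • G g ∂μ) - G g‖ ^ 2 ∂μ with hvG
  have mono : ∀ {p q : Γ → ℝ}, Continuous p → Continuous q → (∀ g, p g ≤ q g) →
      ∫ g, f g * p g ∂μ ≤ ∫ g, f g * q g ∂μ := fun hp hq h =>
    integral_mono (integrable_mul_of_hasCompactSupport hf hfs hp)
      (integrable_mul_of_hasCompactSupport hf hfs hq)
      fun g => mul_le_mul_of_nonneg_left (h g) (hf0 g)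
  have hvar : vF ≤ l ^ 2 * vG := by
    have h1 : ∀ t, ∫ g, f g * ‖F t - F g‖ ^ 2 ∂μ ≤ l ^ 2 * ∫ g, f g * ‖G t - G g‖ ^ 2 ∂μ := by
      intro t
      rw [← integral_const_mul]
      simp_rw [mul_left_comm (l ^ 2)]
      refine mono (by fun_prop) (by fun_prop) fun g => ?_
      rw [← mul_pow]
      exact pow_le_pow_left₀ (norm_nonneg _) (hFG g t) 2
    have cont : ∀ {P : Γ → H}, Continuous P →
        Continuous fun t => ∫ g, f g * ‖P t - P g‖ ^ 2 ∂μ := fun {P} hP => by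
      simp_rw [fun t => integral_mul_norm_sub_sq hf hfs hf1 hP (P t)]
      fun_prop
    have h2 := mono (cont hF) ((cont hG).const_mul (l ^ 2)) h1
    simp_rw [mul_left_comm _ (l ^ 2)] at h2
    rw [integral_const_mul, integral_mul_integral_mul_norm_sub_sq hf hfs hf1 hF,
      integral_mul_integral_mul_norm_sub_sq hf hfs hf1 hG] at h2
    linarith
  have h3 : ∫ g, f g * ‖b - G g‖ ^ 2 ∂μ ≤ l ^ 2 * vF := by
    rw [hvF, ← integral_const_mul]
    simp_rw [mul_left_comm (l ^ 2)]
    refine mono (by fun_prop) (by fun_prop) fun g => ?_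
    rw [← mul_pow]
    exact pow_le_pow_left₀ (norm_nonneg _) (hb g) 2
  -- The mean squared distance from `b` to `G` is at most `l ^ 2 * vF`, and the variance part of it
  -- is at least `(l ^ 2)⁻¹ * vF`; only the difference is left for the bias.
  rw [integral_mul_norm_sub_sq hf hfs hf1 hG] at h3
  have hl2 : 0 < l ^ 2 := by positivity
  have h4 : (l ^ 2)⁻¹ * vF ≤ vG := (inv_mul_le_iff₀ hl2).2 hvar
  have h5 : (l ^ 2)⁻¹ ≤ l ^ 2 :=
    (inv_le_one_of_one_le₀ (one_le_pow₀ hl1)).trans (one_le_pow₀ hl1)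
  calc ‖b - ∫ g, f g • G g ∂μ‖ ^ 2 ≤ (l ^ 2 - (l ^ 2)⁻¹) * vF := by
        rw [sub_mul]; linarith
    _ ≤ _ := mul_le_mul_of_nonneg_left hc (sub_nonneg.2 h5)

end Barycenter

/-- For `k` in a compact neighbourhood `N` of `1` the integrands vanish off one compact set, so the
integral is continuous in `k`. -/
theorem tendsto_integral_abs_translate_sub {Γ : Type*} [Group Γ] [TopologicalSpace Γ]
    [IsTopologicalGroup Γ] [LocallyCompactSpace Γ] [MeasurableSpace Γ] [BorelSpace Γ] {μ : Measure Γ}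
    [IsFiniteMeasureOnCompacts μ] {f : Γ → ℝ} (hf : Continuous f)
    (hfs : HasCompactSupport f) :
    Tendsto (fun k => ∫ g, |f (k⁻¹ * g) - f g| ∂μ) (𝓝 1) (𝓝 0) := by
  obtain ⟨N, hN, hN1⟩ := exists_compact_mem_nhds (1 : Γ)
  have := continuousOn_integral_of_compact_support (μ := μ)
    (f := fun k g => |f (k⁻¹ * g) - f g|) (s := N) (k := N * tsupport f ∪ tsupport f)
    ((hN.mul hfs).union hfs) (by fun_prop) (fun k g hk hg => by
      have h1 : f g = 0 := image_eq_zero_of_notMem_tsupport fun h => hg (Or.inr h)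
      have h2 : f (k⁻¹ * g) = 0 := image_eq_zero_of_notMem_tsupport fun h =>
        hg (Or.inl ⟨k, hk, _, h, by simp⟩)
      simp [h1, h2])
  simpa [ContinuousAt] using this.continuousAt hN1

theorem integral_mul_norm_sub_sq_le {Γ : Type*} [Group Γ] [TopologicalSpace Γ]
    [MeasurableSpace Γ] [BorelSpace Γ] {μ : Measure Γ} [IsFiniteMeasureOnCompacts μ] {H : Type*}
    [NormedAddCommGroup H] [MulAction Γ H] [ContinuousSMul Γ H] {f : Γ → ℝ}
    (hf : Continuous f) (hfs : HasCompactSupport f)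
    (hf0 : ∀ g, 0 ≤ f g) (hf1 : ∫ g, f g ∂μ = 1) {x : H} {R : ℝ}
    (hR : ∀ g, f g ≠ 0 → ‖x - g • x‖ ≤ R) : ∫ g, f g * ‖x - g • x‖ ^ 2 ∂μ ≤ R ^ 2 := by
  have hfi : Integrable f μ := hf.integrable_of_hasCompactSupport hfs
  calc ∫ g, f g * ‖x - g • x‖ ^ 2 ∂μ ≤ ∫ g, f g * R ^ 2 ∂μ := by
        refine integral_mono (integrable_mul_of_hasCompactSupport hf hfs (by fun_prop))
          (hfi.mul_const _) fun g => ?_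
        by_cases hg : f g = 0
        · simp [hg]
        · exact mul_le_mul_of_nonneg_left (pow_le_pow_left₀ (norm_nonneg _) (hR g hg) 2) (hf0 g)
    _ = R ^ 2 := by rw [integral_mul_const, hf1, one_mul]

/-! ### Displacement of orbit averages -/

section OrbitBarycenter

variable {Γ : Type*} [Group Γ] [TopologicalSpace Γ] [MeasurableSpace Γ] [BorelSpace Γ]
  {μ : Measure Γ} [IsFiniteMeasureOnCompacts μ] {H : Type*} [NormedAddCommGroup H]
  [InnerProductSpace ℝ H] [CompleteSpace H] [MulAction Γ H] [ContinuousSMul Γ H] {f : Γ → ℝ}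

theorem norm_sub_orbit_barycenter_le (hf : Continuous f) (hfs : HasCompactSupport f)
    (hf0 : ∀ g, 0 ≤ f g) (hf1 : ∫ g, f g ∂μ = 1) {x : H} {R : ℝ} (hR0 : 0 ≤ R)
    (hR : ∀ g, f g ≠ 0 → ‖x - g • x‖ ≤ R) : ‖x - ∫ g, f g • g • x ∂μ‖ ≤ R := by
  have h1 := integral_mul_norm_sub_sq_le hf hfs hf0 hf1 hR
  have hF : Continuous fun g : Γ => g • x := by fun_prop
  rw [integral_mul_norm_sub_sq hf hfs hf1 hF] at h1
  have h2 : 0 ≤ ∫ g, f g * ‖(∫ g, f g • g • x ∂μ) - g • x‖ ^ 2 ∂μ :=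
    integral_nonneg fun g => mul_nonneg (hf0 g) (sq_nonneg _)
  exact (sq_le_sq₀ (norm_nonneg _) hR0).1 (by linarith)

/-- An almost isometric group element `k` moves an average of an orbit by little more than `R` times
the `L¹`-distance of the density `f` to its translate by `k`. -/
theorem norm_smul_orbit_barycenter_sub_le [IsTopologicalGroup Γ] [μ.IsMulLeftInvariant]
    (hf : Continuous f) (hfs : HasCompactSupport f) (hf0 : ∀ g, 0 ≤ f g) (hf1 : ∫ g, f g ∂μ = 1) {x : H} {R l : ℝ}
    {k : Γ} (hl : 1 ≤ l) (hk : IsBilipschitz l fun x : H => k • x)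
    (hR : ∀ g, f g ≠ 0 → ‖x - g • x‖ ≤ R) (hkR : ∀ g, f (k⁻¹ * g) ≠ 0 → ‖x - g • x‖ ≤ R) :
    ‖k • (∫ g, f g • g • x ∂μ) - ∫ g, f g • g • x ∂μ‖ ≤
      √((l ^ 2 - (l ^ 2)⁻¹) * R ^ 2) + R * ∫ g, |f (k⁻¹ * g) - f g| ∂μ := by
  have hF : Continuous fun g : Γ => g • x := by fun_prop
  have hG : Continuous fun g : Γ => k • g • x := by fun_prop
  have hf' : Continuous fun g => f (k⁻¹ * g) := by fun_prop
  have hfs' : HasCompactSupport fun g => f (k⁻¹ * g) :=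
    hfs.comp_homeomorph (Homeomorph.mulLeft k⁻¹)
  have h1 : ‖k • (∫ g, f g • g • x ∂μ) - ∫ g, f g • k • g • x ∂μ‖ ≤
      √((l ^ 2 - (l ^ 2)⁻¹) * R ^ 2) := by
    refine Real.le_sqrt_of_sq_le (norm_sub_barycenter_sq_le hf hfs hf0 hf1 hF hG
      (zero_lt_one.trans_le hl) (fun s t => ?_) (fun s => ?_) ?_ hl)
    · simpa only [dist_eq_norm] using (hk (t • x) (s • x)).2
    · simpa only [dist_eq_norm] using (hk _ (s • x)).1
    · have h2 := integral_mul_norm_sub_sq_le hf hfs hf0 hf1 hR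
      rw [integral_mul_norm_sub_sq hf hfs hf1 hF] at h2
      linarith [sq_nonneg ‖x - ∫ g, f g • g • x ∂μ‖]
  -- Left invariance moves `k` from the orbit to the density.
  have h3 : ∫ g, f g • k • g • x ∂μ = ∫ g, f (k⁻¹ * g) • g • x ∂μ := by
    rw [← integral_mul_left_eq_self (fun g => f (k⁻¹ * g) • g • x) k]
    simp [mul_smul]
  have h4 : ∫ g, f (k⁻¹ * g) ∂μ = 1 := by rw [integral_mul_left_eq_self f, hf1]
  have hmove : Continuous fun g : Γ => g • x - x := by fun_prop
  -- Both densities have mass `1`, so `x` can be subtracted from the orbit; the bound then involves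
  -- `R` and not the norm of `x`.
  have h5 : (∫ g, f (k⁻¹ * g) • g • x ∂μ) - ∫ g, f g • g • x ∂μ =
      ∫ g, (f (k⁻¹ * g) - f g) • (g • x - x) ∂μ := by
    have e : ∀ {p : Γ → ℝ}, Continuous p → HasCompactSupport p → ∫ g, p g ∂μ = 1 →
        ∫ g, p g • g • x ∂μ = (∫ g, p g • (g • x - x) ∂μ) + x := fun {p} hp hps hp1 => by
      simp_rw [smul_sub]
      rw [integral_sub (integrable_smul_of_hasCompactSupport hp hps hF)
        ((hp.integrable_of_hasCompactSupport hps).smul_const x), integral_smul_const, hp1, one_smul,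
        sub_add_cancel]
    rw [e hf' hfs' h4, e hf hfs hf1, add_sub_add_right_eq_sub,
      ← integral_sub (integrable_smul_of_hasCompactSupport hf' hfs' hmove)
        (integrable_smul_of_hasCompactSupport hf hfs hmove)]
    simp_rw [← sub_smul]
  have h6 : ‖∫ g, (f (k⁻¹ * g) - f g) • (g • x - x) ∂μ‖ ≤ R * ∫ g, |f (k⁻¹ * g) - f g| ∂μ := by
    rw [← integral_const_mul]
    refine norm_integral_le_of_norm_le (Integrable.const_mul (Integrable.abs
      ((hf'.integrable_of_hasCompactSupport hfs').sub (hf.integrable_of_hasCompactSupport hfs))) R)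
      (Eventually.of_forall fun g => ?_)
    rw [norm_smul, Real.norm_eq_abs, mul_comm, norm_sub_rev]
    by_cases h : f g = 0 ∧ f (k⁻¹ * g) = 0
    · simp [h.1, h.2]
    · refine mul_le_mul_of_nonneg_right ?_ (abs_nonneg _)
      rw [not_and_or] at h
      exact h.elim (hR g) (hkR g)
  rw [h3] at h1
  rw [h5.symm] at h6
  exact (norm_sub_le_norm_sub_add_norm_sub _ _ _).trans (add_le_add h1 h6)

end OrbitBarycenter

/-! ### Property (T) on incomplete spaces -/

/-- An action of a group with property (T) by isometries of a semi-inner product space, not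
necessarily complete or separated, with continuous orbit maps has almost fixed points. -/
theorem PropertyT.exists_dist_le {Γ : Type u} [Group Γ] [TopologicalSpace Γ] [IsTopologicalGroup Γ]
    (hT : PropertyT.{u, v} Γ) {E : Type v} [SeminormedAddCommGroup E] [InnerProductSpace ℝ E]
    (act : Γ → E → E) (act_one : ∀ x, act 1 x = x)
    (act_mul : ∀ g h x, act (g * h) x = act g (act h x))
    (act_isom : ∀ g, Isometry (act g))
    (act_cont : ∀ x, Tendsto (fun g => dist (act g x) x) (𝓝 1) (𝓝 0))
    {δ : ℝ} (hδ : 0 < δ) : ∃ x, ∀ g, dist (act g x) x ≤ δ := by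
  let M : MulAction Γ (UniformSpace.Completion E) :=
    { smul g := UniformSpace.Completion.map (act g)
      one_smul x := by
        change UniformSpace.Completion.map (act 1) x = x
        rw [show act 1 = id from funext act_one, UniformSpace.Completion.map_id, id]
      mul_smul g h x := by
        change UniformSpace.Completion.map (act (g * h)) x =
          UniformSpace.Completion.map (act g) (UniformSpace.Completion.map (act h) x)
        rw [show act (g * h) = act g ∘ act h from funext (act_mul g h),
          ← UniformSpace.Completion.map_comp (act_isom g).uniformContinuous
            (act_isom h).uniformContinuous, Function.comp_apply] }
  have isom : ∀ g : Γ, Isometry (fun x : UniformSpace.Completion E => g • x) :=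
    fun g => (act_isom g).completion_map
  have smul_coe : ∀ (g : Γ) (x : E), g • (x : UniformSpace.Completion E) = (act g x : E) :=
    fun g x => UniformSpace.Completion.map_coe (act_isom g).uniformContinuous x
  have orbit : ∀ x : UniformSpace.Completion E,
      Tendsto (fun g : Γ => dist (g • x) x) (𝓝 1) (𝓝 0) := by
    intro x
    rw [Metric.tendsto_nhds]
    intro η hη
    obtain ⟨y, hy⟩ := UniformSpace.Completion.denseRange_coe.exists_dist_lt x
      (show 0 < η / 3 by positivity)
    filter_upwards [Metric.tendsto_nhds.1 (act_cont y) (η / 3) (by positivity)] with g hg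
    rw [Real.dist_0_eq_abs, abs_of_nonneg dist_nonneg] at hg ⊢
    have h1 : dist (g • x) (g • (y : UniformSpace.Completion E)) = dist x y := (isom g).dist_eq _ _
    have h2 : dist (g • (y : UniformSpace.Completion E)) y = dist (act g y) y := by
      rw [smul_coe, UniformSpace.Completion.dist_eq]
    have h3 := dist_triangle4 (g • x) (g • (y : UniformSpace.Completion E)) y x
    rw [dist_comm (y : UniformSpace.Completion E) x] at h3
    linarith
  -- For isometries, joint continuity at `(g₀, x₀)` follows from continuity at `1` of the orbit map
  -- of `x₀`.
  have hcont : ContinuousSMul Γ (UniformSpace.Completion E) := by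
    refine ⟨continuous_iff_continuousAt.2 fun ⟨g₀, x₀⟩ => ?_⟩
    rw [ContinuousAt, tendsto_iff_dist_tendsto_zero]
    have hg : Tendsto (fun p : Γ × UniformSpace.Completion E => g₀⁻¹ * p.1) (𝓝 (g₀, x₀)) (𝓝 1) := by
      have : Continuous fun p : Γ × UniformSpace.Completion E => g₀⁻¹ * p.1 := by fun_prop
      simpa using this.tendsto (g₀, x₀)
    have hx : Tendsto (fun p : Γ × UniformSpace.Completion E => dist p.2 x₀) (𝓝 (g₀, x₀)) (𝓝 0) := by
      have : Continuous fun p : Γ × UniformSpace.Completion E => dist p.2 x₀ := by fun_prop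
      simpa using this.tendsto (g₀, x₀)
    refine squeeze_zero (fun _ => dist_nonneg) (fun p => ?_)
      (by simpa using hx.add ((orbit x₀).comp hg))
    have h1 : dist (p.1 • p.2) (p.1 • x₀) = dist p.2 x₀ := (isom p.1).dist_eq _ _
    have h2 := (isom g₀).dist_eq ((g₀⁻¹ * p.1) • x₀) x₀
    rw [smul_smul, mul_inv_cancel_left] at h2
    dsimp only
    linarith [dist_triangle (p.1 • p.2) (p.1 • x₀) (g₀ • x₀)]
  obtain ⟨z, hz⟩ := hT (UniformSpace.Completion E) isom
  obtain ⟨y, hy⟩ := UniformSpace.Completion.denseRange_coe.exists_dist_lt z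
    (show 0 < δ / 2 by positivity)
  refine ⟨y, fun g => ?_⟩
  rw [← UniformSpace.Completion.dist_eq, ← smul_coe]
  have h1 : dist (g • z) (g • (y : UniformSpace.Completion E)) = dist z y := (isom g).dist_eq _ _
  rw [hz g, dist_comm] at h1
  linarith [dist_triangle (g • (y : UniformSpace.Completion E)) z y]

/-! ### Ultralimits of Hilbert spaces -/

section Ultraproduct

/-- Bounded sequences in Hilbert spaces, with the distance that is the limit of the distances along
an ultrafilter, form a semi-inner product space. -/
theorem exists_ultraproduct {H : ℕ → Type v} [∀ n, NormedAddCommGroup (H n)]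
    [∀ n, InnerProductSpace ℝ (H n)] (ω : Ultrafilter ℕ) (V : Submodule ℝ (∀ n, H n))
    (hV : ∀ x ∈ V, ∃ C, ∀ n, ‖x n‖ ≤ C) :
    ∃ (E : Type v) (_ : SeminormedAddCommGroup E) (_ : InnerProductSpace ℝ E) (e : V ≃ E),
      ∀ x y : V, Tendsto (fun n => ‖x.1 n - y.1 n‖) ω (𝓝 (dist (e x) (e y))) := by
  have hlim : ∀ x y : V, ∃ a : ℝ, Tendsto (fun n => inner ℝ (x.1 n) (y.1 n)) ω (𝓝 a) := by
    intro x y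
    obtain ⟨C, hC⟩ := hV x x.2
    obtain ⟨D, hD⟩ := hV y y.2
    obtain ⟨a, -, ha⟩ := (isCompact_Icc (a := -(C * D)) (b := C * D)).ultrafilter_le_nhds
      (ω.map fun n => inner ℝ (x.1 n) (y.1 n)) (by
        rw [Ultrafilter.coe_map, le_principal_iff]
        refine mem_map.2 (univ_mem' fun n => abs_le.1 ((abs_real_inner_le_norm _ _).trans ?_))
        exact mul_le_mul (hC n) (hD n) (norm_nonneg _) ((norm_nonneg _).trans (hC n)))
    exact ⟨a, ha⟩
  choose ip hip using hlim
  let c : PreInnerProductSpace.Core ℝ V :=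
    { inner := ip
      conj_inner_symm := fun x y => by
        refine tendsto_nhds_unique (hip y x) ((hip x y).congr fun n => ?_)
        exact real_inner_comm _ _
      re_inner_nonneg := fun x =>
        ge_of_tendsto' (hip x x) fun n => real_inner_self_nonneg
      add_left := fun x y z => by
        refine tendsto_nhds_unique (hip (x + y) z) (((hip x z).add (hip y z)).congr fun n => ?_)
        exact (inner_add_left _ _ _).symm
      smul_left := fun x y r => by
        refine tendsto_nhds_unique (hip (r • x) y) (((hip x y).const_mul r).congr fun n => ?_)
        exact (real_inner_smul_left _ _ _).symm }
  let S : SeminormedAddCommGroup V := InnerProductSpace.Core.toSeminormedAddCommGroup (c := c)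
  -- No quotient by null sequences is taken: a seminorm suffices, since the completion separates
  -- points later.
  refine ⟨V, S, InnerProductSpace.ofCore c, Equiv.refl V, fun x y => ?_⟩
  have hd : dist x y = √(ip (x - y) (x - y)) := @dist_eq_norm V S x y
  rw [Equiv.refl_apply, Equiv.refl_apply, hd]
  refine (hip (x - y) (x - y)).sqrt.congr fun n => ?_
  rw [real_inner_self_eq_norm_sq, Real.sqrt_sq (norm_nonneg _)]
  rfl

end Ultraproduct

/-! ### Almost isometries are almost affine -/

section AlmostAffine

/-- Stewart's identity: distances to `a` and `b` determine the distance to any point of their line.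
-/
theorem norm_sub_affine_sq {H : Type*} [NormedAddCommGroup H] [InnerProductSpace ℝ H]
    (w a b : H) (t : ℝ) :
    ‖w - ((1 - t) • a + t • b)‖ ^ 2 =
      (1 - t) * ‖w - a‖ ^ 2 + t * ‖w - b‖ ^ 2 - t * (1 - t) * ‖a - b‖ ^ 2 := by
  rw [show w - ((1 - t) • a + t • b) = (1 - t) • (w - a) + t • (w - b) by module,
    show a - b = (w - b) - (w - a) by abel, norm_add_sq_real,
    norm_sub_sq_real (w - b) (w - a), norm_smul,
    norm_smul, mul_pow, mul_pow, Real.norm_eq_abs, Real.norm_eq_abs, sq_abs, sq_abs,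
    inner_smul_left, inner_smul_right, real_inner_comm (w - a) (w - b)]
  simp only [conj_trivial]
  ring

theorem IsBilipschitz.abs_norm_sq_sub_le {H : Type*} [NormedAddCommGroup H] {c : ℝ}
    (hc : 1 ≤ c) {h : H → H} (hh : IsBilipschitz c h) (x y : H) :
    |‖h x - h y‖ ^ 2 - ‖x - y‖ ^ 2| ≤ (c ^ 2 - (c ^ 2)⁻¹) * ‖x - y‖ ^ 2 := by
  obtain ⟨h1, h2⟩ := hh x y
  rw [dist_eq_norm, dist_eq_norm] at h1 h2
  have h3 := pow_le_pow_left₀ (norm_nonneg _) h1 2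
  have h4 := pow_le_pow_left₀ (norm_nonneg _) h2 2
  rw [mul_pow] at h3 h4
  have hc2 : 1 ≤ c ^ 2 := one_le_pow₀ hc
  have h5 := (inv_mul_le_iff₀ (zero_lt_one.trans_le hc2)).2 h4
  have h6 := mul_le_mul_of_nonneg_right hc2 (sq_nonneg ‖x - y‖)
  have h7 := mul_le_mul_of_nonneg_right (inv_le_one_of_one_le₀ hc2) (sq_nonneg ‖x - y‖)
  rw [abs_le, sub_mul]
  constructor <;> linarith

/-- A map that is nearly an isometry is nearly affine. -/
theorem IsBilipschitz.norm_sub_affine_sq_le {H : Type*} [NormedAddCommGroup H]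
    [InnerProductSpace ℝ H] {c : ℝ} (hc : 1 ≤ c) {h : H → H}
    (hh : IsBilipschitz c h) (x y : H) (t : ℝ) :
    ‖h ((1 - t) • x + t • y) - ((1 - t) • h x + t • h y)‖ ^ 2 ≤
      (c ^ 2 - (c ^ 2)⁻¹) * ((|1 - t| * t ^ 2 + |t| * (1 - t) ^ 2 + |t * (1 - t)|) *
        ‖x - y‖ ^ 2) := by
  set m := (1 - t) • x + t • y with hm
  have e1 : ‖m - x‖ ^ 2 = t ^ 2 * ‖x - y‖ ^ 2 := by
    rw [show m - x = (-t) • (x - y) by rw [hm]; module, norm_smul, mul_pow, Real.norm_eq_abs,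
      sq_abs, neg_sq]
  have e2 : ‖m - y‖ ^ 2 = (1 - t) ^ 2 * ‖x - y‖ ^ 2 := by
    rw [show m - y = (1 - t) • (x - y) by rw [hm]; module, norm_smul, mul_pow, Real.norm_eq_abs,
      sq_abs]
  have key : ∀ r a b : ℝ, |a| ≤ b → r * a ≤ |r| * b := fun r a b hab =>
    (le_abs_self _).trans (by rw [abs_mul]; exact mul_le_mul_of_nonneg_left hab (abs_nonneg r))
  -- For `w = m` the right side of `norm_sub_affine_sq` is zero before applying `h`. Afterwards only
  -- the distortions of the three squared distances remain, one estimate for each.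
  have h1 := key (1 - t) _ _ (hh.abs_norm_sq_sub_le hc m x)
  have h2 := key t _ _ (hh.abs_norm_sq_sub_le hc m y)
  have h3 := key (-(t * (1 - t))) _ _ (hh.abs_norm_sq_sub_le hc x y)
  rw [abs_neg] at h3
  rw [norm_sub_affine_sq]
  rw [e1] at h1
  rw [e2] at h2
  linear_combination h1 + h2 + h3

end AlmostAffine

/-! ### Tame sequences and the limit action -/

section AsymptoticallyIsometric

/-- A sequence of actions that are uniformly bilipschitz on compact subsets of the group, with
constants tending to `1` along `l`, and for which the orbits of the origins are uniformly bounded on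
compact subsets of the group. -/
structure AsymptoticallyIsometric (Γ : Type u) [Group Γ] [TopologicalSpace Γ] (l : Filter ℕ)
    (H : ℕ → Type v) [∀ n, NormedAddCommGroup (H n)] [∀ n, MulAction Γ (H n)] : Prop where
  bilipschitz : ∀ T : Set Γ, IsCompact T → ∃ c : ℕ → ℝ, (∀ n, 1 ≤ c n) ∧ (∃ B, ∀ n, c n ≤ B) ∧
    Tendsto c l (𝓝 1) ∧ ∀ n, ∀ g ∈ T, IsBilipschitz (c n) fun x : H n => g • x
  bounded : ∀ T : Set Γ, IsCompact T → ∃ R, 0 ≤ R ∧ ∀ n, ∀ g ∈ T, ‖g • (0 : H n)‖ ≤ R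

/-- A bounded sequence of points whose orbit maps are asymptotically equicontinuous at `1`. -/
structure IsTame (Γ : Type u) [Group Γ] [TopologicalSpace Γ] (l : Filter ℕ)
    {H : ℕ → Type v} [∀ n, NormedAddCommGroup (H n)] [∀ n, MulAction Γ (H n)]
    (x : ∀ n, H n) : Prop where
  bounded : ∃ C, ∀ n, ‖x n‖ ≤ C
  tendsto : Tendsto (fun p : Γ × ℕ => ‖p.1 • x p.2 - x p.2‖) (𝓝 1 ×ˢ l) (𝓝 0)

variable {Γ : Type u} [Group Γ] [TopologicalSpace Γ] {l : Filter ℕ}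
  {H : ℕ → Type v} [∀ n, NormedAddCommGroup (H n)] [∀ n, MulAction Γ (H n)]

theorem tendsto_sq_sub_inv_sq {α : Type*} {k : Filter α} {c : α → ℝ} (hc : Tendsto c k (𝓝 1)) :
    Tendsto (fun n => c n ^ 2 - (c n ^ 2)⁻¹) k (𝓝 0) := by
  have := (hc.pow 2).sub ((hc.pow 2).inv₀ (by norm_num))
  simpa using this

theorem tendsto_sqrt_of_tendsto_zero {α : Type*} {k : Filter α} {c : α → ℝ}
    (hc : Tendsto c k (𝓝 0)) : Tendsto (fun n => √(c n)) k (𝓝 0) := by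
  simpa using hc.sqrt

/-- The orbit barycenters of the origins work: their displacement is bounded by one term that
vanishes along `l` and one, independent of `n`, that vanishes as the group element tends to `1`. -/
theorem AsymptoticallyIsometric.exists_isTame [IsTopologicalGroup Γ] [LocallyCompactSpace Γ]
    [∀ n, InnerProductSpace ℝ (H n)] [∀ n, CompleteSpace (H n)] [∀ n, ContinuousSMul Γ (H n)]
    (hH : AsymptoticallyIsometric Γ l H) : ∃ b : ∀ n, H n, IsTame Γ l b := by
  let : MeasurableSpace Γ := borel Γ
  have : BorelSpace Γ := ⟨rfl⟩
  let μ : Measure Γ := Measure.haar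
  obtain ⟨f₀, hfs₀, hf0₀, hne⟩ := exists_continuous_nonneg_pos (1 : Γ)
  have hpos : 0 < ∫ g, f₀ g ∂μ :=
    f₀.continuous.integral_pos_of_hasCompactSupport_nonneg_nonzero hfs₀ hf0₀ hne
  obtain ⟨f, hf, hfs, hf0, hf1⟩ : ∃ f : Γ → ℝ, Continuous f ∧ HasCompactSupport f ∧
      (∀ g, 0 ≤ f g) ∧ ∫ g, f g ∂μ = 1 :=
    ⟨fun g => (∫ g, f₀ g ∂μ)⁻¹ * f₀ g, by fun_prop, hfs₀.mul_left,
      fun g => mul_nonneg (inv_nonneg.2 hpos.le) (hf0₀ g), by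
        rw [integral_const_mul, inv_mul_cancel₀ hpos.ne']⟩
  obtain ⟨N, hN, hN1⟩ := exists_compact_mem_nhds (1 : Γ)
  obtain ⟨R, hR0, hR⟩ := hH.bounded (N * tsupport f ∪ tsupport f) ((hN.mul hfs).union hfs)
  obtain ⟨c, hc1, -, hc, hcN⟩ := hH.bilipschitz N hN
  have hRf : ∀ n g, f g ≠ 0 → ‖0 - g • (0 : H n)‖ ≤ R := fun n g hg => by
    rw [zero_sub, norm_neg]
    exact hR n g (Or.inr (subset_tsupport f hg))
  refine ⟨fun n => ∫ g, f g • g • (0 : H n) ∂μ, ⟨R, fun n => ?_⟩, ?_⟩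
  · simpa using norm_sub_orbit_barycenter_le hf hfs hf0 hf1 hR0 (hRf n)
  · have h1 : Tendsto (fun p : Γ × ℕ => √((c p.2 ^ 2 - (c p.2 ^ 2)⁻¹) * R ^ 2)) (𝓝 1 ×ˢ l) (𝓝 0) :=
      tendsto_sqrt_of_tendsto_zero (by
        simpa using (tendsto_sq_sub_inv_sq (hc.comp tendsto_snd)).mul_const (R ^ 2))
    have h2 : Tendsto (fun p : Γ × ℕ => R * ∫ g, |f (p.1⁻¹ * g) - f g| ∂μ) (𝓝 1 ×ˢ l) (𝓝 0) := by
      simpa using ((tendsto_integral_abs_translate_sub (μ := μ) hf hfs).comp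
        tendsto_fst).const_mul R
    refine squeeze_zero' (Eventually.of_forall fun _ => norm_nonneg _) ?_
      (by simpa using h1.add h2)
    filter_upwards [prod_mem_prod hN1 univ_mem] with p hp
    refine norm_smul_orbit_barycenter_sub_le hf hfs hf0 hf1 (hc1 p.2) (hcN p.2 p.1 hp.1)
      (hRf p.2) fun g hg => ?_
    rw [zero_sub, norm_neg]
    exact hR p.2 g (Or.inl ⟨p.1, hp.1, p.1⁻¹ * g, subset_tsupport f hg, by simp⟩)

theorem IsTame.affine [∀ n, InnerProductSpace ℝ (H n)] [LocallyCompactSpace Γ]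
    (hH : AsymptoticallyIsometric Γ l H) {x y : ∀ n, H n} (hx : IsTame Γ l x) (hy : IsTame Γ l y)
    (t : ℝ) : IsTame Γ l ((1 - t) • x + t • y) := by
  obtain ⟨C, hC⟩ := hx.bounded
  obtain ⟨D, hD⟩ := hy.bounded
  refine ⟨⟨|1 - t| * C + |t| * D, fun n => ?_⟩, ?_⟩
  · refine (norm_add_le _ _).trans (add_le_add ?_ ?_)
    · simpa [norm_smul] using mul_le_mul_of_nonneg_left (hC n) (abs_nonneg (1 - t))
    · simpa [norm_smul] using mul_le_mul_of_nonneg_left (hD n) (abs_nonneg t)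
  obtain ⟨N, hN, hN1⟩ := exists_compact_mem_nhds (1 : Γ)
  obtain ⟨c, hc1, -, hc, hcN⟩ := hH.bilipschitz N hN
  set A := (|1 - t| * t ^ 2 + |t| * (1 - t) ^ 2 + |t * (1 - t)|) * (C + D) ^ 2
  have h1 : Tendsto (fun p : Γ × ℕ => √((c p.2 ^ 2 - (c p.2 ^ 2)⁻¹) * A)) (𝓝 1 ×ˢ l) (𝓝 0) :=
    tendsto_sqrt_of_tendsto_zero (by
      simpa using (tendsto_sq_sub_inv_sq (hc.comp tendsto_snd)).mul_const A)
  have h2 := (h1.add (hx.tendsto.const_mul |1 - t|)).add (hy.tendsto.const_mul |t|)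
  refine squeeze_zero' (Eventually.of_forall fun _ => norm_nonneg _) ?_ (by simpa using h2)
  filter_upwards [prod_mem_prod hN1 univ_mem] with p hp
  have hc2 : 1 ≤ c p.2 ^ 2 := one_le_pow₀ (hc1 p.2)
  have hb : ‖p.1 • ((1 - t) • x p.2 + t • y p.2) - ((1 - t) • p.1 • x p.2 + t • p.1 • y p.2)‖ ≤
      √((c p.2 ^ 2 - (c p.2 ^ 2)⁻¹) * A) := by
    refine Real.le_sqrt_of_sq_le (((hcN p.2 p.1 hp.1).norm_sub_affine_sq_le (hc1 p.2) (x p.2)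
      (y p.2) t).trans ?_)
    refine mul_le_mul_of_nonneg_left (mul_le_mul_of_nonneg_left ?_ (by positivity))
      (sub_nonneg.2 ((inv_le_one_of_one_le₀ hc2).trans hc2))
    exact pow_le_pow_left₀ (norm_nonneg _)
      ((norm_sub_le _ _).trans (add_le_add (hC p.2) (hD p.2))) 2
  have e : ∀ m a b a' b' : H p.2, m - ((1 - t) • a + t • b) = (m - ((1 - t) • a' + t • b')) +
      (1 - t) • (a' - a) + t • (b' - b) := fun m a b a' b' => by module
  rw [Pi.add_apply, Pi.smul_apply, Pi.smul_apply, e _ _ _ (p.1 • x p.2) (p.1 • y p.2)]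
  refine norm_add₃_le.trans (add_le_add_three hb ?_ ?_) <;> rw [norm_smul, Real.norm_eq_abs]

/-- Moving `g • x n` by `u` amounts, up to the Lipschitz constant of `g`, to moving `x n` by `g⁻¹ *
u * g`, which tends to `1` with `u`. -/
theorem IsTame.smul [IsTopologicalGroup Γ] (hH : AsymptoticallyIsometric Γ l H) {x : ∀ n, H n}
    (hx : IsTame Γ l x) (g : Γ) : IsTame Γ l fun n => g • x n := by
  obtain ⟨c, hc1, ⟨B, hB⟩, -, hcg⟩ := hH.bilipschitz {g} isCompact_singleton
  obtain ⟨R, -, hR⟩ := hH.bounded {g} isCompact_singleton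
  obtain ⟨C, hC⟩ := hx.bounded
  have hlip : ∀ n (y z : H n), ‖g • y - g • z‖ ≤ B * ‖y - z‖ := fun n y z => by
    have := (hcg n g rfl y z).1
    rw [dist_eq_norm, dist_eq_norm] at this
    exact this.trans (mul_le_mul_of_nonneg_right (hB n) (norm_nonneg _))
  have hB0 : 0 ≤ B := zero_le_one.trans ((hc1 0).trans (hB 0))
  refine ⟨⟨B * C + R, fun n => ?_⟩, ?_⟩
  · have h1 := hlip n (x n) 0
    rw [sub_zero] at h1
    have h2 := norm_add_le (g • x n - g • (0 : H n)) (g • 0)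
    rw [sub_add_cancel] at h2
    linarith [mul_le_mul_of_nonneg_left (hC n) hB0, hR n g rfl]
  · have hconj : Tendsto (fun p : Γ × ℕ => (g⁻¹ * p.1 * g, p.2)) (𝓝 1 ×ˢ l) (𝓝 1 ×ˢ l) := by
      have h : Continuous fun u : Γ => g⁻¹ * u * g := by fun_prop
      have h1 : Tendsto (fun u : Γ => g⁻¹ * u * g) (𝓝 1) (𝓝 1) := by simpa using h.tendsto 1
      exact (h1.comp tendsto_fst).prodMk tendsto_snd
    refine squeeze_zero (fun _ => norm_nonneg _) (fun p => ?_)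
      (by simpa using (hx.tendsto.comp hconj).const_mul B)
    have := hlip p.2 ((g⁻¹ * p.1 * g) • x p.2) (x p.2)
    simpa [smul_smul, mul_assoc] using this

/-- The tame sequences, as a linear space with origin at a tame sequence `b`. -/
def tameSubmodule [∀ n, InnerProductSpace ℝ (H n)] [LocallyCompactSpace Γ]
    (hH : AsymptoticallyIsometric Γ l H) {b : ∀ n, H n} (hb : IsTame Γ l b) :
    Submodule ℝ (∀ n, H n) :=
  have smul_mem : ∀ (t : ℝ) (x : ∀ n, H n), IsTame Γ l (b + x) → IsTame Γ l (b + t • x) :=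
    fun t x hx => by
      have := hb.affine hH hx t
      rwa [show (1 - t) • b + t • (b + x) = b + t • x by module] at this
  { carrier := {x | IsTame Γ l (b + x)}
    zero_mem' := by simpa using hb
    add_mem' := fun {x y} hx hy => by
      -- The sum is twice the midpoint, seen from `b`.
      have := IsTame.affine hH hx hy (1 / 2)
      rw [show (1 - 1 / 2 : ℝ) • (b + x) + (1 / 2 : ℝ) • (b + y) =
        b + (1 / 2 : ℝ) • (x + y) by module] at this
      simpa [smul_smul] using smul_mem 2 _ this
    smul_mem' := fun t x hx => smul_mem t x hx }

/-- Asymptotically isometric actions of a group with property (T) have tame sequences of almost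
fixed points. -/
theorem AsymptoticallyIsometric.exists_isTame_norm_smul_sub_le [IsTopologicalGroup Γ]
    [LocallyCompactSpace Γ] [∀ n, InnerProductSpace ℝ (H n)] [∀ n, CompleteSpace (H n)]
    [∀ n, ContinuousSMul Γ (H n)] {ω : Ultrafilter ℕ} (hT : PropertyT.{u, v} Γ)
    (hH : AsymptoticallyIsometric Γ ω H) {δ : ℝ} (hδ : 0 < δ) :
    ∃ x : ∀ n, H n, IsTame Γ ω x ∧ ∀ g : Γ, ∀ᶠ n in ω, ‖g • x n - x n‖ < δ := by
  obtain ⟨b, hb⟩ := hH.exists_isTame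
  have hbd : ∀ x ∈ tameSubmodule hH hb, ∃ C, ∀ n, ‖x n‖ ≤ C := fun x hx => by
    obtain ⟨C, hC⟩ := hb.bounded
    obtain ⟨D, hD⟩ := (show IsTame Γ ω (b + x) from hx).bounded
    refine ⟨D + C, fun n => ?_⟩
    have := norm_sub_le ((b + x) n) (b n)
    rw [Pi.add_apply, add_sub_cancel_left] at this
    linarith [hC n, hD n, show ‖b n + x n‖ ≤ D from hD n]
  obtain ⟨E, _, _, e, he⟩ := exists_ultraproduct ω (tameSubmodule hH hb) hbd
  let a : Γ → tameSubmodule hH hb → tameSubmodule hH hb := fun g x =>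
    ⟨fun n => g • (b n + x.1 n) - b n, by
      have h : IsTame Γ ω fun n => g • (b + x.1) n :=
        IsTame.smul hH (show IsTame Γ ω (b + x.1) from x.2) g
      change IsTame Γ ω _
      convert h using 1
      funext n
      simp⟩
  have ha : ∀ g (x : tameSubmodule hH hb) n, b n + (a g x).1 n = g • (b n + x.1 n) :=
    fun g x n => by simp [a]
  obtain ⟨z, hz⟩ := hT.exists_dist_le (E := E) (fun g x => e (a g (e.symm x)))
    (fun x => by
      rw [← Equiv.eq_symm_apply]
      ext n
      simp [a])
    (fun g h x => by
      rw [Equiv.symm_apply_apply]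
      congr 1
      ext n
      simp [a, mul_smul])
    (fun g => by
      refine Isometry.of_dist_eq fun x y => ?_
      obtain ⟨x, rfl⟩ := e.surjective x
      obtain ⟨y, rfl⟩ := e.surjective y
      simp only [Equiv.symm_apply_apply]
      refine tendsto_nhds_unique (he _ _) ?_
      -- Distances change by factors between `(c n)⁻¹` and `c n`, both tending to `1`, so the limit
      -- action is isometric.
      obtain ⟨c, hc1, -, hc, hcg⟩ := hH.bilipschitz {g} isCompact_singleton
      have hd := he x y
      refine tendsto_of_tendsto_of_tendsto_of_le_of_le
        (by simpa using (hc.inv₀ one_ne_zero).mul hd) (by simpa using hc.mul hd)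
        (fun n => ?_) (fun n => ?_)
      · have := (hcg n g rfl (b n + x.1 n) (b n + y.1 n)).2
        rw [dist_eq_norm, dist_eq_norm, add_sub_add_left_eq_sub] at this
        simpa [a] using (inv_mul_le_iff₀ (zero_lt_one.trans_le (hc1 n))).2 this
      · have := (hcg n g rfl (b n + x.1 n) (b n + y.1 n)).1
        rw [dist_eq_norm, dist_eq_norm, add_sub_add_left_eq_sub] at this
        simpa [a] using this)
    (fun x => by
      obtain ⟨x, rfl⟩ := e.surjective x
      simp only [Equiv.symm_apply_apply]
      rw [Metric.tendsto_nhds]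
      intro η hη
      have hx : IsTame Γ ω (b + x.1) := x.2
      have h1 := Metric.tendsto_nhds.1 hx.tendsto (η / 2) (by positivity)
      filter_upwards [h1.curry] with g hg
      rw [Real.dist_0_eq_abs, abs_of_nonneg dist_nonneg]
      refine (le_of_tendsto (he (a g x) x) ?_).trans_lt (half_lt_self hη)
      filter_upwards [hg] with n hn
      rw [Real.dist_0_eq_abs, abs_of_nonneg (norm_nonneg _)] at hn
      rw [← add_sub_add_left_eq_sub _ _ (b n), ha]
      exact hn.le)
    (half_pos hδ)
  obtain ⟨x, rfl⟩ := e.surjective z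
  refine ⟨b + x.1, x.2, fun g => ?_⟩
  have h2 := hz g
  simp only [Equiv.symm_apply_apply] at h2
  filter_upwards [(he (a g x) x).eventually_lt_const (h2.trans_lt (half_lt_self hδ))] with n hn
  rwa [← add_sub_add_left_eq_sub _ _ (b n), ha] at hn

end AsymptoticallyIsometric

/-! ### Halving the displacement by contradiction -/

section Halving

variable {Γ : Type u} [Group Γ] [TopologicalSpace Γ] [IsTopologicalGroup Γ] [LocallyCompactSpace Γ]
  {K : Set Γ}

theorem asymptoticallyIsometric_of_isAlmostIsometry (hgen : Subgroup.closure K = ⊤) {l : Filter ℕ}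
    {H : ℕ → Type v} [∀ n, NormedAddCommGroup (H n)] [∀ n, MulAction Γ (H n)]
    [∀ n, ContinuousSMul Γ (H n)] {ε : ℕ → ℝ} (h0 : ∀ n, 0 ≤ ε n) (h1 : ∀ n, ε n ≤ 1 / 2)
    (hε : Tendsto ε l (𝓝 0)) (hK : ∀ n, ∀ k ∈ K, IsAlmostIsometry (ε n) (fun x : H n => k • x))
    (hD : ∀ n, ∀ k ∈ K, dist (0 : H n) (k • 0) ≤ 1) : AsymptoticallyIsometric Γ l H := by
  have hpos : ∀ n, 0 < 1 - ε n := fun n => by linarith [h1 n]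
  have hinv : ∀ n, 1 ≤ (1 - ε n)⁻¹ := fun n => (one_le_inv₀ (hpos n)).2 (by linarith [h0 n])
  refine ⟨fun T hT => ?_, fun T hT => ?_⟩
  · obtain ⟨m, hm⟩ := hT.subset_closure_symmHull_pow hgen
    refine ⟨fun n => (1 - ε n)⁻¹ ^ m, fun n => one_le_pow₀ (hinv n), ⟨2 ^ m, fun n => ?_⟩, ?_,
      fun n g hg => isBilipschitz_of_mem_closure (h0 n) (h1 n) (hK n) (hm hg)⟩
    · refine pow_le_pow_left₀ (zero_le_one.trans (hinv n)) ?_ m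
      rw [inv_le_comm₀ (hpos n) two_pos]
      linarith [h1 n]
    · simpa using (((tendsto_const_nhds (x := (1 : ℝ))).sub hε).inv₀ (by norm_num)).pow m
  · obtain ⟨m, hm⟩ := hT.subset_closure_symmHull_pow hgen
    refine ⟨4 ^ m, by positivity, fun n g hg => ?_⟩
    have := dist_smul_le_of_mem_closure (h0 n) (h1 n) (hK n) (hm hg) (hD n) zero_le_one
    rwa [dist_zero_left, mul_one] at this

/-- For actions that displace the origin by at most `1` and are close to isometric, there is a point
within a uniform distance of the origin with displacement at most `1 / 2`. -/
theorem PropertyT.exists_dist_smul_le_half_of_dist_zero_le (hT : PropertyT.{u, v} Γ)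
    (hK : IsCompact K) (hgen : Subgroup.closure K = ⊤) :
    ∃ ε : ℝ, 0 < ε ∧ ∃ C : ℝ, ∀ (H : Type v) [NormedAddCommGroup H] [InnerProductSpace ℝ H]
      [CompleteSpace H] [MulAction Γ H] [ContinuousSMul Γ H],
      (∀ k ∈ K, IsAlmostIsometry ε (fun x : H => k • x)) →
      (∀ k ∈ K, dist (0 : H) (k • 0) ≤ 1) →
      ∃ z : H, ‖z‖ ≤ C ∧ ∀ k ∈ K, dist z (k • z) ≤ 1 / 2 := by
  by_contra! hcon
  -- The shift by one makes the constant `1 / (n + 2)`, which never exceeds `1 / 2`.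
  have hε0 : ∀ n : ℕ, (0 : ℝ) < 1 / ((n + 1 : ℕ) + 1) := fun n => by positivity
  choose H i1 i2 i3 i4 i5 hal hD hno using fun n : ℕ => hcon (1 / ((n + 1 : ℕ) + 1)) (hε0 n) n
  have hε1 : ∀ n : ℕ, (1 : ℝ) / ((n + 1 : ℕ) + 1) ≤ 1 / 2 := fun n => by
    refine one_div_le_one_div_of_le two_pos ?_
    push_cast
    linarith [(Nat.cast_nonneg n : (0 : ℝ) ≤ n)]
  have hH : AsymptoticallyIsometric Γ (hyperfilter ℕ : Filter ℕ) H :=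
    asymptoticallyIsometric_of_isAlmostIsometry hgen (fun n => (hε0 n).le) hε1
      (((tendsto_add_atTop_iff_nat 1).2 tendsto_one_div_add_atTop_nhds_zero_nat).mono_left
        Nat.hyperfilter_le_atTop) hal hD
  obtain ⟨x, hx, hfix⟩ := hH.exists_isTame_norm_smul_sub_le hT (show (0 : ℝ) < 1 / 8 by norm_num)
  have hsmall := Metric.tendsto_nhds.1 hx.tendsto (1 / 8) (by norm_num)
  obtain ⟨U, hU, P, hP, hUP⟩ := Filter.eventually_prod_iff.1 hsmall
  -- Finitely many translates `j • U` cover `K`. An element `j * u` then moves `x n` by at most `(1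
  -- + 1 / 2) / 8 + 1 / 8 < 1 / 2`.
  obtain ⟨t, htK, htc⟩ := hK.elim_nhds_subcover (fun k => k • {u | U u}) fun k _ => by
    simpa using smul_mem_nhds_smul k hU
  have hfin : ∀ᶠ n in (hyperfilter ℕ : Filter ℕ), ∀ k ∈ t, ‖k • x n - x n‖ < 1 / 8 :=
    (Filter.eventually_all_finset t).2 fun k _ => hfix k
  obtain ⟨C, hC⟩ := hx.bounded
  have hlarge : ∀ᶠ n : ℕ in (hyperfilter ℕ : Filter ℕ), C ≤ n :=
    Nat.hyperfilter_le_atTop (tendsto_natCast_atTop_atTop.eventually_ge_atTop C)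
  obtain ⟨n, hn1, hn2, hn3⟩ := (hfin.and (hP.and hlarge)).exists
  obtain ⟨k, hk, hlt⟩ := hno n (x n) ((hC n).trans hn3)
  obtain ⟨j, hj, u, hu, rfl⟩ := mem_iUnion₂.1 (htc hk)
  have h1 := hUP hu hn2
  rw [Real.dist_0_eq_abs, abs_of_nonneg (norm_nonneg _), ← dist_eq_norm] at h1
  have h2 := (hal n j (htK j hj) (u • x n) (x n)).2
  have h3 := hn1 j hj
  rw [← dist_eq_norm] at h3
  have h4 := dist_triangle ((j • u) • x n) (j • x n) (x n)
  rw [dist_comm (x n)] at hlt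
  simp only [smul_eq_mul, mul_smul] at hlt h2 h4
  have h5 := mul_le_mul_of_nonneg_right (hε1 n) (dist_nonneg (x := u • x n) (y := x n))
  simp only at h1
  linarith

/-- Conjugation of an action on a real vector space by the homothety `x ↦ y + c • x`. -/
@[reducible]
noncomputable def MulAction.conjHomothety (Γ : Type*) [Group Γ] {H : Type*} [AddCommGroup H]
    [Module ℝ H] [MulAction Γ H] (y : H) {c : ℝ} (hc : c ≠ 0) : MulAction Γ H where
  smul g x := c⁻¹ • (g • (y + c • x) - y)
  one_smul x := by
    change c⁻¹ • ((1 : Γ) • (y + c • x) - y) = x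
    simp [smul_smul, hc]
  mul_smul g h x := by
    change c⁻¹ • ((g * h) • (y + c • x) - y) =
      c⁻¹ • (g • (y + c • c⁻¹ • (h • (y + c • x) - y)) - y)
    rw [smul_inv_smul₀ hc, add_sub_cancel, mul_smul]

/-- Conjugating by the homothety that takes `0` to `y` with ratio `D` keeps almost isometry
constants and divides displacements by `D`. -/
theorem PropertyT.exists_dist_smul_le_half (hT : PropertyT.{u, v} Γ)
    (hK : IsCompact K) (hgen : Subgroup.closure K = ⊤) :
    ∃ ε : ℝ, 0 < ε ∧ ∃ C : ℝ, 0 < C ∧ ∀ (H : Type v) [NormedAddCommGroup H] [InnerProductSpace ℝ H]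
      [CompleteSpace H] [MulAction Γ H] [ContinuousSMul Γ H],
      (∀ k ∈ K, IsAlmostIsometry ε (fun x : H => k • x)) → ∀ (y : H) (D : ℝ), 0 < D →
      (∀ k ∈ K, dist y (k • y) ≤ D) →
      ∃ z : H, dist y z ≤ C * D ∧ ∀ k ∈ K, dist z (k • z) ≤ D / 2 := by
  obtain ⟨ε, hε, C, hC⟩ := hT.exists_dist_smul_le_half_of_dist_zero_le hK hgen
  refine ⟨ε, hε, max C 1, by positivity, fun H _ _ _ _ _ hal y D hD hy => ?_⟩
  have hdist : ∀ a b : H, dist (D⁻¹ • (a - y)) (D⁻¹ • (b - y)) = D⁻¹ * dist a b := fun a b => by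
    rw [dist_smul₀, dist_sub_right, Real.norm_eq_abs, abs_of_pos (inv_pos.2 hD)]
  obtain ⟨z, hz, hzK⟩ := @hC H _ _ _ (MulAction.conjHomothety Γ y hD.ne')
    (by
      refine @ContinuousSMul.mk Γ H (MulAction.conjHomothety Γ y hD.ne').toSMul _ _ ?_
      change Continuous fun p : Γ × H => D⁻¹ • (p.1 • (y + D • p.2) - y)
      fun_prop)
    (fun k hk a b => by
      have hab : dist (y + D • a) (y + D • b) = D * dist a b := by
        rw [dist_add_left, dist_smul₀, Real.norm_eq_abs, abs_of_pos hD]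
      have h := hal k hk (y + D • a) (y + D • b)
      change (1 - ε) * dist a b ≤ dist (D⁻¹ • (k • (y + D • a) - y)) (D⁻¹ • (k • (y + D • b) - y)) ∧
        dist (D⁻¹ • (k • (y + D • a) - y)) (D⁻¹ • (k • (y + D • b) - y)) ≤ (1 + ε) * dist a b
      rw [hab] at h
      rw [hdist, le_inv_mul_iff₀ hD, inv_mul_le_iff₀ hD]
      exact ⟨by linarith [h.1], by linarith [h.2]⟩)
    (fun k hk => by
      change dist (0 : H) (D⁻¹ • (k • (y + D • (0 : H)) - y)) ≤ 1
      have h := hdist y (k • y)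
      rw [sub_self, smul_zero] at h
      rw [smul_zero, add_zero, h, inv_mul_le_iff₀ hD, mul_one]
      exact hy k hk)
  refine ⟨y + D • z, ?_, fun k hk => ?_⟩
  · rw [dist_self_add_right, norm_smul, Real.norm_eq_abs, abs_of_pos hD, mul_comm]
    exact mul_le_mul_of_nonneg_right (hz.trans (le_max_left _ _)) hD.le
  · have h : dist z (D⁻¹ • (k • (y + D • z) - y)) ≤ 1 / 2 := hzK k hk
    have h1 := hdist (y + D • z) (k • (y + D • z))
    rw [add_sub_cancel_left, inv_smul_smul₀ hD.ne'] at h1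
    rw [h1, inv_mul_le_iff₀ hD] at h
    linarith

end Halving

/-! ### From halving to fixed points -/

theorem mem_fixedPoints_of_closure_eq_top {Γ X : Type*} [Group Γ] [MulAction Γ X] {K : Set Γ}
    (hgen : Subgroup.closure K = ⊤) {x : X} (hx : ∀ k ∈ K, k • x = x) :
    x ∈ MulAction.fixedPoints Γ X := fun g =>
  ((Subgroup.closure_le (MulAction.stabilizer Γ x)).2 hx) (hgen ▸ Subgroup.mem_top g)

theorem dist_smul_le_displacement {Γ X : Type*} [Group Γ] [TopologicalSpace Γ] [MetricSpace X]
    [MulAction Γ X] [ContinuousSMul Γ X] {K : Set Γ} (hK : IsCompact K) (x : X) {k : Γ}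
    (hk : k ∈ K) : dist x (k • x) ≤ displacement K x :=
  le_csSup (hK.image (by fun_prop)).bddAbove (mem_image_of_mem _ hk)

theorem displacement_nonneg {Γ X : Type*} [Group Γ] [MetricSpace X] [MulAction Γ X] (K : Set Γ)
    (x : X) : 0 ≤ displacement K x :=
  Real.sSup_nonneg (by rintro _ ⟨k, -, rfl⟩; exact dist_nonneg)

/-- If displacements can be halved within a distance proportional to them, then there are fixed
points within a distance proportional to the displacement. -/
theorem exists_mem_fixedPoints_dist_le {Γ X : Type*} [Group Γ] [TopologicalSpace Γ] [MetricSpace X]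
    [CompleteSpace X] [MulAction Γ X] [ContinuousSMul Γ X] {K : Set Γ}
    (hgen : Subgroup.closure K = ⊤) {C : ℝ}
    (h : ∀ (y : X) (D : ℝ), 0 < D → (∀ k ∈ K, dist y (k • y) ≤ D) →
      ∃ z : X, dist y z ≤ C * D ∧ ∀ k ∈ K, dist z (k • z) ≤ D / 2)
    (y : X) {D : ℝ} (hD : 0 < D) (hy : ∀ k ∈ K, dist y (k • y) ≤ D) :
    ∃ z ∈ MulAction.fixedPoints Γ X, dist y z ≤ 2 * C * D := by
  let A : ℕ → Type _ := fun n => {z : X // ∀ k ∈ K, dist z (k • z) ≤ D / 2 ^ n}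
  have hstep : ∀ n (z : A n), ∃ w : A (n + 1), dist z.1 w.1 ≤ C * (D / 2 ^ n) := fun n z => by
    obtain ⟨w, hw, hwK⟩ := h z.1 (D / 2 ^ n) (by positivity) z.2
    exact ⟨⟨w, fun k hk => by rw [pow_succ, ← div_div]; exact hwK k hk⟩, hw⟩
  choose F hF using hstep
  let s : ∀ n, A n := fun n => Nat.rec ⟨y, by simpa using hy⟩ F n
  have hs : ∀ n, dist (s n).1 (s (n + 1)).1 ≤ 2 * C * D / 2 / 2 ^ n := fun n =>
    (hF n (s n)).trans_eq (by ring)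
  obtain ⟨z, hz⟩ := cauchySeq_tendsto_of_complete (cauchySeq_of_le_geometric_two hs)
  refine ⟨z, mem_fixedPoints_of_closure_eq_top hgen fun k hk => ?_,
    dist_le_of_le_geometric_two_of_tendsto₀ hs hz⟩
  have h1 : Tendsto (fun n => dist (s n).1 (k • (s n).1)) atTop (𝓝 (dist z (k • z))) :=
    hz.dist (hz.const_smul k)
  have h2 : Tendsto (fun n : ℕ => D / 2 ^ n) atTop (𝓝 0) :=
    tendsto_const_nhds.div_atTop (tendsto_pow_atTop_atTop_of_one_lt one_lt_two)
  exact (dist_le_zero.1 (le_of_tendsto_of_tendsto' h1 h2 fun n => (s n).2 k hk)).symm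

theorem theorem1p6 {Γ : Type u} [Group Γ] [TopologicalSpace Γ] [IsTopologicalGroup Γ]
    [LocallyCompactSpace Γ] [SigmaCompactSpace Γ] (hT : PropertyT.{u, v} Γ)
    (K : Set Γ) (hK : IsCompact K) (hgen : Subgroup.closure K = ⊤) :
    ∃ ε : ℝ, 0 < ε ∧ ∃ D : ℝ, 0 < D ∧
      ∀ (H : Type v) [NormedAddCommGroup H] [InnerProductSpace ℝ H] [CompleteSpace H]
        [MulAction Γ H] [ContinuousSMul Γ H],
        (∀ k ∈ K, IsAlmostIsometry ε (fun x : H => k • x)) →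
          (MulAction.fixedPoints Γ H).Nonempty ∧
          ∀ y : H, Metric.infDist y (MulAction.fixedPoints Γ H) ≤ D * displacement K y := by
  obtain ⟨ε, hε, C, hC, h⟩ := hT.exists_dist_smul_le_half hK hgen
  refine ⟨ε, hε, 2 * C, by positivity, fun H _ _ _ _ _ hal => ?_⟩
  have key : ∀ y : H, ∃ z ∈ MulAction.fixedPoints Γ H, dist y z ≤ 2 * C * displacement K y := by
    intro y
    -- Halving needs `D > 0`; a point of zero displacement is already fixed.
    rcases (displacement_nonneg K y).eq_or_lt with h0 | hpos
    · refine ⟨y, mem_fixedPoints_of_closure_eq_top hgen fun k hk => ?_, by simp [← h0]⟩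
      exact (dist_le_zero.1 (h0 ▸ dist_smul_le_displacement hK y hk)).symm
    · exact exists_mem_fixedPoints_dist_le hgen (h H hal) y hpos
        fun k hk => dist_smul_le_displacement hK y hk
  refine ⟨?_, fun y => ?_⟩
  · obtain ⟨z, hz, -⟩ := key 0
    exact ⟨z, hz⟩
  · obtain ⟨z, hz, hle⟩ := key y
    exact (Metric.infDist_le_dist_of_mem hz).trans hle
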